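/- **Theorem (Singleton bound).** Let $q$ be a power of a prime $p$, let $n\ge 1$, $0\le k\le n$ and $m\ge 0$ be integers, and let $(\beta,\beta^q)$ be a normal basis of $\mathbf F_{q^2}/\mathbf F_q$. *Convolutional stabilizer codes.* On the qudit space $\mathbf C^q$ with basis $\{|x\rangle : x\in\mathbf F_q\}$ let $X(a)|x\rangle=|x+a\rangle$ and $Z(b)|x\rangle=\exp(2\pi i\,\mathrm{tr}(bx)/p)|x\rangle$ for $a,b\in\mathbf F_q$, where $\mathrm{tr}$ is the absolute trace; put $\omega=\exp(2\pi i/p)$. Let $P_t$ be the group generated by the tensor products of $(t+1)n+m$ operators $X(a)$, $Z(b)$, let $Z_t$ be its center, and let $P_\infty$ be the direct limit of the $P_t$ under $M\mapsto M\otimes I^{\otimes n}$; thus $P_\infty$ consists of the operators $\omega^cX(a_0)Z(b_0)\otimes X(a_1)Z(b_1)\otimes\cdots$ with almost all $a_i,b_i$ zero. The weight of such an operator is the number of $i\ge 0$ with $(a_i,b_i)\ne(0,0)$. Let $S_0$ be an abelian subgroup of $P_0$, put $S_t=\langle N\otimes I^{\otimes n},\, I^{\otimes tn}\otimes M : N\in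 S_{t-1}, M\in S_0\rangle$ for $t\ge 1$, and let $S=\varinjlim S_t\le P_\infty$. Assume that - (S1) $I^{\otimes tn}\otimes M$ and $N\otimes I^{\otimes tn}$ commute for all $M,N\in S_0$ and $t\ge 1$; - (S2) for all $t\ge 0$, $S_tZ_t/Z_t$ is a $(t+1)(n-k)$-dimensional $\mathbf F_q$-subspace of $P_t/Z_t$, which is identified with the space of all pairs of vectors $(a,b)$ over $\mathbf F_q$ of length $(t+1)n+m$; - (S3) for all $t\ge 0$, $S_t\cap Z_t$ contains only the identity. Then $S$ defines an $[(n,k,m)]_q$ convolutional stabilizer code $Q$. An error $E\in P_\infty$ is detectable by $Q$ if a scalar multiple of $E$ lies in $S$ or $E$ fails to commute with some element of $S$. The code $Q$ has free distance $d_f$ if all errors of weight less than $d_f$ are detectable, but some error of weight $d_f$ is not. It is pure if every element of $S$ other than the identity has weight at least $d_f$. *Degree.* Let $C\subseteq \mathbf F_{q^2}[D]^n$ be the set of all $u(D)$ for which the coefficient sequence of $\sum_{i=0}^{n-1}D^iu_i(D^n)$ is $(\beta a_0+\beta^qb_0,\ \beta a_1+\beta^qb_1,\dots)$ for some element $\omega^cX(a_0)Z(b_0)\otimes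 X(a_1)Z(b_1)\otimes\cdots$ of $S$. The code $Q$ is $\mathbf F_{q^2}$-linear if $C$ is an $\mathbf F_{q^2}$-linear subspace; then $C$ is an $\mathbf F_{q^2}[D]$-submodule. In this case the degree of $Q$ is $\delta=\sum_i\nu_i=\max\{\deg\gamma : \gamma \text{ a maximal minor of } G\}$, where $G=(g_{ij})$ is a right-invertible polynomial matrix, with row degrees $\nu_i=\max_j\deg g_{ij}$ satisfying the second equality, whose rows generate the module of all polynomial vectors in the $\mathbf F_{q^2}(D)$-span of $C$ (this module is $C$ itself if $C$ has a right-invertible polynomial generator matrix). *Claim.* If $Q$ is $\mathbf F_{q^2}$-linear and pure, with degree $\delta$ and free distance $d_f$, then $$d_f\le \frac{n-k}{2}\left(\left\lfloor\frac{2\delta}{n+k}\right\rfloor+1\right)+\delta+1 .$$ -/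

import Mathlib

open Polynomial Matrix

noncomputable section

namespace QConv

/-! ### Classical convolutional codes -/

section Classical

variable {K : Type*} [Field K] {n r : ℕ}

/-- The submodule `{u G | u ∈ K[D]^r}` of `K[D]^n` generated by the rows of `G`, as a set. -/
def rowCode (G : Matrix (Fin r) (Fin n) K[X]) : Set (Fin n → K[X]) :=
  {v | ∃ u : Fin r → K[X], v = u ᵥ* G}

/-- The row degree `ν_i = max_j deg g_{ij}`. -/
def rowDegree (G : Matrix (Fin r) (Fin n) K[X]) (i : Fin r) : ℕ :=
  Finset.univ.sup fun j => (G i j).natDegree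

/-- The degrees of the nonzero `r`-minors (all `r × r` minors) of an `r × n` matrix. -/
def minorDegrees (G : Matrix (Fin r) (Fin n) K[X]) : Set ℕ :=
  {e | ∃ f : Fin r ↪o Fin n, (G.submatrix id f).det ≠ 0 ∧ (G.submatrix id f).det.natDegree = e}

/-- `C` is an `(n, r, δ)` convolutional code: it is generated by a right-invertible polynomial
`r × n` matrix `G` with `∑ ν_i = max {deg γ | γ an r-minor of G} = δ`. -/
def IsConvCode (C : Set (Fin n → K[X])) (r δ : ℕ) : Prop :=
  ∃ G : Matrix (Fin r) (Fin n) K[X],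
    (∃ H : Matrix (Fin n) (Fin r) K[X], G * H = 1) ∧
    C = rowCode G ∧
    ∑ i, rowDegree G i = δ ∧
    IsGreatest (minorDegrees G) δ

/-- For a `K[D]`-submodule `C` of `K[D]^n`: the polynomial vectors in the `K(D)`-span of `C`. -/
def saturation (C : Set (Fin n → K[X])) : Set (Fin n → K[X]) :=
  {v | ∃ f : K[X], f ≠ 0 ∧ f • v ∈ C}

/-- A code that has a right-invertible generator matrix is equal to its saturation. -/
theorem saturation_rowCode (G : Matrix (Fin r) (Fin n) K[X])
    (hG : ∃ H : Matrix (Fin n) (Fin r) K[X], G * H = 1) :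
    saturation (rowCode G) = rowCode G := by
  obtain ⟨H, hH⟩ := hG
  ext v
  constructor
  · rintro ⟨f, hf, u, hu⟩
    refine ⟨v ᵥ* H, ?_⟩
    have h1 : (f • v) ᵥ* H = u := by
      rw [hu, Matrix.vecMul_vecMul, hH, Matrix.vecMul_one]
    have h2 : f • v = f • ((v ᵥ* H) ᵥ* G) := by
      rw [← Matrix.smul_vecMul, ← Matrix.smul_vecMul, h1, hu]
    exact smul_right_injective _ hf h2
  · intro hv
    exact ⟨1, one_ne_zero, by simpa using hv⟩

/-- `δ` is the degree of the `K[D]`-submodule `C` of `K[D]^n`.  If `C` itself has a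
right-invertible generator matrix, then `saturation C = C`, and `δ` is the degree of the
convolutional code `C`.  Otherwise (all polynomial generator matrices of `C` are catastrophic) the
right-invertible generator matrix is, as usual, obtained from one of `C` by a left multiplication
with an invertible matrix of rational functions; it generates `saturation C`. -/
def HasDegree (C : Set (Fin n → K[X])) (δ : ℕ) : Prop :=
  ∃ r : ℕ, IsConvCode (saturation C) r δ

/-- The interleaving map `σ`: the polynomial `∑_i D^i u_i(D^n)`, which stands for its coefficient
sequence. -/
def interleave (u : Fin n → K[X]) : K[X] :=
  ∑ i : Fin n, X ^ (i : ℕ) * (u i).comp (X ^ n)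

end Classical

/-! ### The Pauli group on a one-sided infinite stream of `q`-ary qudits -/

section Pauli

variable (F : Type*)

/-- States of the stream of qudits indexed by `ℕ`: the function `f` stands for the formal
superposition `∑_x f(x) |x⟩` of the product basis states `|x⟩ = |x_0⟩ ⊗ |x_1⟩ ⊗ ⋯`. -/
abbrev States := (ℕ → F) → ℂ

/-- The group of invertible linear operators on the stream of qudits. -/
abbrev Op := (Module.End ℂ (States F))ˣ

variable {F}

/-- The sequence `x_0, …, x_{s-1}, y_0, y_1, …`. -/
def splice (s : ℕ) (x y : ℕ → F) : ℕ → F := fun i => if i < s then x i else y (i - s)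

/-- The operator `I^{⊗ s} ⊗ M`: it applies `M` to the qudits `s, s + 1, …`. -/
def shiftEnd (s : ℕ) : Module.End ℂ (States F) →* Module.End ℂ (States F) where
  toFun M :=
    { toFun := fun f x => M (fun y => f (splice s x y)) (fun i => x (i + s))
      map_add' := fun f g => by
        funext x
        exact congrFun (M.map_add (fun y => f (splice s x y)) (fun y => g (splice s x y))) _
      map_smul' := fun z f => by
        funext x
        exact congrFun (M.map_smul z (fun y => f (splice s x y))) _ }
  map_one' := by
    ext f x
    simp only [LinearMap.coe_mk, AddHom.coe_mk, Module.End.one_apply]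
    congr 1
    funext i
    simp only [splice]
    split_ifs with h
    · rfl
    · congr 1
      omega
  map_mul' M N := by
    have h1 : ∀ x y z : ℕ → F, splice s (splice s x y) z = splice s x z := by
      intro x y z
      funext i
      simp only [splice]
      split_ifs <;> rfl
    have h2 : ∀ x y : ℕ → F, (fun i => splice s x y (i + s)) = y := by
      intro x y
      funext i
      simp [splice]
    ext f x
    simp only [LinearMap.coe_mk, AddHom.coe_mk, Module.End.mul_apply, h1, h2]

/-- `M ↦ I^{⊗ s} ⊗ M` on invertible operators. -/
def shift (s : ℕ) : Op F →* Op F := Units.map (shiftEnd s)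

variable [Field F]

/-- `X(a) = X(a_0) ⊗ X(a_1) ⊗ ⋯`, the operator `|x⟩ ↦ |x + a⟩`, where almost all `a_i` are 0. -/
def opX (a : ℕ →₀ F) : Op F where
  val := { toFun := fun f x => f (x - a), map_add' := fun _ _ => rfl, map_smul' := fun _ _ => rfl }
  inv := { toFun := fun f x => f (x + a), map_add' := fun _ _ => rfl, map_smul' := fun _ _ => rfl }
  val_inv := by
    ext f x
    simp
  inv_val := by
    ext f x
    simp

variable (p : ℕ) [Fact p.Prime] [Algebra (ZMod p) F]

/-- The character `x ↦ exp (2πi tr(x) / p)`, where `tr` is the absolute trace from `F` to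
`ZMod p`. -/
def chi (x : F) : ℂ := ZMod.stdAddChar (Algebra.trace (ZMod p) F x)

theorem chi_mul_chi_neg (x : F) : chi p x * chi p (-x) = 1 := by
  rw [chi, chi, ← AddChar.map_add_eq_mul, ← map_add, add_neg_cancel, map_zero,
    AddChar.map_zero_eq_one]

theorem chi_neg_mul_chi (x : F) : chi p (-x) * chi p x = 1 := by
  rw [mul_comm, chi_mul_chi_neg]

/-- `Z(b) = Z(b_0) ⊗ Z(b_1) ⊗ ⋯`, the operator `|x⟩ ↦ ∏_i exp (2πi tr(b_i x_i) / p) |x⟩`, where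
almost all `b_i` are 0. -/
def opZ (b : ℕ →₀ F) : Op F where
  val :=
    { toFun := fun f x => chi p (b.sum fun i y => y * x i) * f x
      map_add' := fun _ _ => by
        funext x
        simp [mul_add]
      map_smul' := fun _ _ => by
        funext x
        simp [mul_left_comm] }
  inv :=
    { toFun := fun f x => chi p (-(b.sum fun i y => y * x i)) * f x
      map_add' := fun _ _ => by
        funext x
        simp [mul_add]
      map_smul' := fun _ _ => by
        funext x
        simp [mul_left_comm] }
  val_inv := by
    ext f x
    simp [← mul_assoc, chi_mul_chi_neg]
  inv_val := by
    ext f x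
    simp [← mul_assoc, chi_neg_mul_chi]

/-- The scalar operator `ω^c` with `ω = exp (2πi / p)`. -/
def opPhase (F : Type*) (p : ℕ) [Fact p.Prime] (c : ZMod p) : Op F :=
  Units.map (algebraMap ℂ (Module.End ℂ (States F))).toMonoidHom
    ⟨ZMod.stdAddChar c, ZMod.stdAddChar (-c),
      by rw [← AddChar.map_add_eq_mul, add_neg_cancel, AddChar.map_zero_eq_one],
      by rw [← AddChar.map_add_eq_mul, neg_add_cancel, AddChar.map_zero_eq_one]⟩

/-- `ω^c X(a_0)Z(b_0) ⊗ X(a_1)Z(b_1) ⊗ ⋯`. -/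
def pauli (c : ZMod p) (a b : ℕ →₀ F) : Op F := opPhase F p c * (opX a * opZ p b)

variable (F)

/-- The Pauli group on the first `N` qudits (tensored with the identity on all the others): the
group generated by the tensor products of operators `X(a_i)`, `Z(b_i)` with `i < N`. -/
def pauliGroup (N : ℕ) : Subgroup (Op F) :=
  Subgroup.closure
    ({E | ∃ a : ℕ →₀ F, (∀ i, N ≤ i → a i = 0) ∧ E = opX a} ∪
      {E | ∃ b : ℕ →₀ F, (∀ i, N ≤ i → b i = 0) ∧ E = opZ p b})

/-- The group `P_∞`, the direct limit (here: the union) of the Pauli groups on finitely many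
qudits. -/
def pauliGroupInf : Subgroup (Op F) := ⨆ N, pauliGroup F p N

variable {F}

/-- `E` is a Pauli operator with exactly `w` non-identity tensor components (up to phases). -/
def HasWeight (E : Op F) (w : ℕ) : Prop :=
  ∃ (c : ZMod p) (a b : ℕ →₀ F), E = pauli p c a b ∧ {i | a i ≠ 0 ∨ b i ≠ 0}.ncard = w

/-! ### Convolutional stabilizer codes -/

/-- `S_0 = S₀` and `S_t = ⟨N ⊗ I^{⊗ n}, I^{⊗ tn} ⊗ M | N ∈ S_{t-1}, M ∈ S_0⟩`. -/
def stab (n : ℕ) (S₀ : Subgroup (Op F)) : ℕ → Subgroup (Op F)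
  | 0 => S₀
  | t + 1 => stab n S₀ t ⊔ S₀.map (shift ((t + 1) * n))

/-- The stabilizer `S`, the direct limit (here: the union) of the groups `S_t`. -/
def stabInf (n : ℕ) (S₀ : Subgroup (Op F)) : Subgroup (Op F) := ⨆ t, stab n S₀ t

/-- The image of a group `T` of Pauli operators modulo phases, where the Pauli group modulo phases
is identified with a vector space by `ω^c X(a) Z(b) ↦ (a, b)`. -/
def modPhases (T : Subgroup (Op F)) : Set ((ℕ →₀ F) × (ℕ →₀ F)) :=
  {v | ∃ c : ZMod p, pauli p c v.1 v.2 ∈ T}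

/-- `S₀` defines a convolutional stabilizer code with parameters `[(n, k, m)]_q`.  Here
`P_t = pauliGroup F p ((t + 1) * n + m)`, with center `Z_t`. -/
structure IsConvStabilizer (n k m : ℕ) (S₀ : Subgroup (Op F)) : Prop where
  pos : 0 < n
  le : k ≤ n
  subgroup : S₀ ≤ pauliGroup F p (n + m)
  abelian : ∀ M ∈ S₀, ∀ N ∈ S₀, Commute M N
  /-- S1: the shifts of the elements of `S₀` commute with the elements of `S₀`. -/
  s1 : ∀ M ∈ S₀, ∀ N ∈ S₀, ∀ t : ℕ, 0 < t → Commute (shift (t * n) M) N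
  /-- S2: `S_t Z_t / Z_t` is a vector space of dimension `(t + 1)(n - k)` over `F`. -/
  s2 : ∀ t : ℕ, ∃ W : Submodule F ((ℕ →₀ F) × (ℕ →₀ F)),
    (W : Set ((ℕ →₀ F) × (ℕ →₀ F))) = modPhases p (stab n S₀ t) ∧
      Module.finrank F W = (t + 1) * (n - k)
  /-- S3: `S_t ∩ Z_t` contains only the identity. -/
  s3 : ∀ t : ℕ, ∀ E ∈ stab n S₀ t,
    (∀ M ∈ pauliGroup F p ((t + 1) * n + m), Commute E M) → E = 1

/-- `E` is detectable by the code with stabilizer `S`: a scalar multiple of `E` is in `S`, or `E`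
does not commute with some element of `S`. -/
def IsDetectable (S : Subgroup (Op F)) (E : Op F) : Prop :=
  (∃ M ∈ S, ∃ z : ℂ, (M : Module.End ℂ (States F)) = z • (E : Module.End ℂ (States F))) ∨
    ∃ M ∈ S, ¬ Commute E M

/-- The code with stabilizer `S` has free distance `d`. -/
def IsFreeDistance (S : Subgroup (Op F)) (d : ℕ) : Prop :=
  (∀ E ∈ pauliGroupInf F p, ∀ w, HasWeight p E w → w < d → IsDetectable S E) ∧
    ∃ E ∈ pauliGroupInf F p, HasWeight p E d ∧ ¬ IsDetectable S E

/-- The code with stabilizer `S` and free distance `d` is pure: `S` contains no error (that is, no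
element other than the identity) of weight less than `d`. -/
def IsPure (S : Subgroup (Op F)) (d : ℕ) : Prop :=
  ∀ E ∈ S, E ≠ 1 → ∀ w, HasWeight p E w → d ≤ w

section Code

variable [Fintype F] {K : Type*} [Field K] [Algebra F K]

/-- The code `σ⁻¹ τ(S)` in `K[D]^n`, where `τ(ω^c X(a_0)Z(b_0) ⊗ X(a_1)Z(b_1) ⊗ ⋯)` is the sequence
`(β a_0 + β^q b_0, β a_1 + β^q b_1, …)`. -/
def assocCode (n : ℕ) (β : K) (S : Subgroup (Op F)) : Set (Fin n → K[X]) :=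
  {u | ∃ (c : ZMod p) (a b : ℕ →₀ F), pauli p c a b ∈ S ∧
    ∀ j, (interleave u).coeff j =
      β * algebraMap F K (a j) + β ^ Fintype.card F * algebraMap F K (b j)}

/-- The code with stabilizer `S` is `K`-linear: `σ⁻¹ τ(S)` is a `K`-linear subspace. -/
def IsLinearCode (n : ℕ) (β : K) (S : Subgroup (Op F)) : Prop :=
  ∃ W : Submodule K (Fin n → K[X]), (W : Set (Fin n → K[X])) = assocCode p n β S

end Code

end Pauli

end QConv

end

noncomputable section

namespace QConv

/-! ### Low-weight vectors in the dual of a convolutional code -/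

section Classical

variable {K : Type*} [Field K] {n r : ℕ}

/-! Write `q` for the cardinality of `F`, and let `r` be the rank of the saturated code, generated
by a right-invertible `G`. Purity means that every nontrivial Pauli operator commuting with `S` has
weight at least `d`, so it is enough to exhibit one of small weight.

Seek a polynomial vector `w` of degree at most `L` with `G w = 0`. It has `n(L+1)` coefficients, and
the equations number `∑ (ν_i + L + 1) = r(L+1) + δ`. If this is less than `n(L+1)`, the support of
`w` can moreover be confined to any `r(L+1) + δ + 1` positions
(`exists_mulVec_eq_zero_of_weight_le`). Reversing `w` in time gives a sequence orthogonal to every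
code word, because the pairing is a single coefficient of the product `(u G) · w = 0`
(`exists_stream_orthogonal`). Applying `x ↦ x^q` turns this into Hermitian orthogonality, hence
symplectic orthogonality, hence a commuting Pauli operator of no larger weight
(`exists_commuting_pauli`).

The rank satisfies `2r ≤ n - k`: each row contributes two elements, multiples by `β` and `β^q`,
independent over `F[D]`, while `S` lies in an `F[D]`-module generated by `n - k` elements
(`two_mul_rank_le`). With `L = ⌊δ/(n-r)⌋` the weight bound increases with `r`, which gives the
claim. -/

theorem coeff_interleave (u : Fin n → K[X]) (i : Fin n) (t : ℕ) :
    (interleave u).coeff (n * t + i) = (u i).coeff t := by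
  have hn : 0 < n := i.pos
  rw [interleave, finsetSum_coeff, Finset.sum_eq_single i]
  · rw [← expand_eq_comp_X_pow, coeff_X_pow_mul, coeff_expand_mul' hn]
  · intro j _ hj
    rw [← expand_eq_comp_X_pow, coeff_X_pow_mul', coeff_expand hn]
    split_ifs with h1 h2
    · exfalso
      apply hj
      obtain ⟨c, hc⟩ := h2
      have h3 : n * t + (i : ℕ) = n * c + j := by omega
      have h4 := congrArg (· % n) h3
      simp only [Nat.mul_add_mod, Nat.mod_eq_of_lt i.2, Nat.mod_eq_of_lt j.2] at h4
      exact Fin.ext h4.symm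
    · rfl
    · rfl
  · simp

theorem natDegree_le_rowDegree (G : Matrix (Fin r) (Fin n) K[X]) (i : Fin r) (j : Fin n) :
    (G i j).natDegree ≤ rowDegree G i :=
  Finset.le_sup (f := fun j => (G i j).natDegree) (Finset.mem_univ j)

/-- The polynomial vector of degree at most `L` with prescribed coefficients. -/
def ofCoeffs (L : ℕ) : (Fin n × Fin (L + 1) → K) →ₗ[K] (Fin n → K[X]) :=
  LinearMap.pi fun j => ∑ t : Fin (L + 1), Polynomial.monomial (t : ℕ) ∘ₗ LinearMap.proj (j, t)

theorem ofCoeffs_apply (L : ℕ) (y : Fin n × Fin (L + 1) → K) (j : Fin n) :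
    ofCoeffs L y j = ∑ t : Fin (L + 1), Polynomial.monomial (t : ℕ) (y (j, t)) := by
  simp [ofCoeffs]

theorem coeff_ofCoeffs (L : ℕ) (y : Fin n × Fin (L + 1) → K) (j : Fin n) (t : Fin (L + 1)) :
    (ofCoeffs L y j).coeff t = y (j, t) := by
  rw [ofCoeffs_apply, finsetSum_coeff, Finset.sum_eq_single t]
  · simp
  · intro s _ hs
    rw [coeff_monomial, if_neg fun h => hs (Fin.ext h)]
  · simp

theorem natDegree_ofCoeffs_le (L : ℕ) (y : Fin n × Fin (L + 1) → K) (j : Fin n) :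
    (ofCoeffs L y j).natDegree ≤ L := by
  rw [ofCoeffs_apply]
  exact natDegree_sum_le_of_forall_le _ _ fun t _ =>
    (natDegree_monomial_le _).trans (Nat.lt_succ_iff.mp t.2)

/-- A generalized Singleton bound for the dual of a convolutional code: if the rows of an
`r × n` matrix `G` have degrees of sum `δ` and `δ < (n - r)(L + 1)`, then some nonzero polynomial
vector of degree at most `L` and weight at most `r(L + 1) + δ + 1` is orthogonal to these rows. -/
theorem exists_mulVec_eq_zero_of_weight_le (G : Matrix (Fin r) (Fin n) K[X]) {δ L : ℕ}
    (hG : ∑ i, rowDegree G i = δ) (hL : r * (L + 1) + δ < n * (L + 1)) :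
    ∃ w : Fin n → K[X], w ≠ 0 ∧ (∀ j, (w j).natDegree ≤ L) ∧ G *ᵥ w = 0 ∧
      ∃ J : Finset (Fin n × Fin (L + 1)), J.card = r * (L + 1) + δ + 1 ∧
        ∀ (j : Fin n) (t : Fin (L + 1)), (w j).coeff t ≠ 0 → (j, t) ∈ J := by
  classical
  -- Any set of positions works, provided it has one more element than there are equations in `A`.
  obtain ⟨J, -, hJ⟩ := Finset.exists_subset_card_eq
    (s := (Finset.univ : Finset (Fin n × Fin (L + 1)))) (n := r * (L + 1) + δ + 1)
    (by simpa using hL)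
  -- `A` records the coefficients of `G w` that can be nonzero: entry `i` has degree at most `ν_i +
  -- L`. `B` records the coefficients of `w` outside `J`. Together they impose `n(L+1) - 1`
  -- conditions on `n(L+1)` unknowns.
  let A : (Fin n × Fin (L + 1) → K) →ₗ[K] ((Σ i : Fin r, Fin (rowDegree G i + L + 1)) → K) :=
    LinearMap.pi fun e => Polynomial.lcoeff K (e.2 : ℕ) ∘ₗ LinearMap.proj e.1 ∘ₗ
      (Matrix.mulVecLin G).restrictScalars K ∘ₗ ofCoeffs L
  let B : (Fin n × Fin (L + 1) → K) →ₗ[K] ((Jᶜ : Finset (Fin n × Fin (L + 1))) → K) :=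
    LinearMap.funLeft K K Subtype.val
  have hker : LinearMap.ker (A.prod B) ≠ ⊥ := by
    apply LinearMap.ker_ne_bot_of_finrank_lt
    rw [Module.finrank_prod, Module.finrank_fintype_fun_eq_card,
      Module.finrank_fintype_fun_eq_card, Module.finrank_fintype_fun_eq_card,
      Fintype.card_coe, Finset.card_compl, hJ]
    have hsum : ∑ i, (rowDegree G i + L + 1) = r * (L + 1) + δ := by
      simp only [add_assoc]
      rw [Finset.sum_add_distrib, hG]
      simp [add_comm]
    simp only [Fintype.card_sigma, Fintype.card_fin, Fintype.card_prod, hsum]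
    omega
  obtain ⟨y, hy, hy0⟩ := Submodule.exists_mem_ne_zero_of_ne_bot hker
  rw [LinearMap.ker_prod, Submodule.mem_inf, LinearMap.mem_ker, LinearMap.mem_ker] at hy
  refine ⟨ofCoeffs L y, fun h => hy0 ?_, natDegree_ofCoeffs_le L y, ?_, J, hJ, ?_⟩
  · ext ⟨j, t⟩
    rw [← coeff_ofCoeffs L y j t, h]
    simp
  · ext i s
    by_cases hs : s < rowDegree G i + L + 1
    · exact congrFun hy.1 ⟨i, ⟨s, hs⟩⟩
    · rw [Pi.zero_apply, coeff_zero]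
      apply coeff_eq_zero_of_natDegree_lt
      have hle : ((G *ᵥ ofCoeffs L y) i).natDegree ≤ rowDegree G i + L := by
        rw [Matrix.mulVec, dotProduct]
        refine natDegree_sum_le_of_forall_le _ _ fun j _ => ?_
        exact natDegree_mul_le.trans
          (add_le_add (natDegree_le_rowDegree G i j) (natDegree_ofCoeffs_le L y j))
      omega
  · intro j t ht
    rw [coeff_ofCoeffs] at ht
    by_contra hJt
    exact ht (congrFun hy.2 ⟨(j, t), Finset.mem_compl.mpr hJt⟩)

/-- The time reversal of the sequence of a vector of degree at most `L` orthogonal to the rows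
of `G` is orthogonal to the sequences of the words of the code generated by `G`. -/
theorem exists_stream_orthogonal (hn : 0 < n) (G : Matrix (Fin r) (Fin n) K[X]) {δ L : ℕ}
    (hG : ∑ i, rowDegree G i = δ) (hL : r * (L + 1) + δ < n * (L + 1)) :
    ∃ y : ℕ →₀ K, y ≠ 0 ∧ y.support.card ≤ r * (L + 1) + δ + 1 ∧
      ∀ u ∈ rowCode G, (y.sum fun j z => (interleave u).coeff j * z) = 0 := by
  classical
  obtain ⟨w, hw0, hdeg, hGw, J, hJ, hwJ⟩ := exists_mulVec_eq_zero_of_weight_le G hG hL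
  -- Frame `t` of the reversed sequence carries the coefficients of `D^(L-t)`. The cutoff matters:
  -- past frame `L`, truncated subtraction would repeat the constant coefficients forever.
  let f : ℕ → K := fun j =>
    if j / n ≤ L then (w ⟨j % n, Nat.mod_lt _ hn⟩).coeff (L - j / n) else 0
  have hfdiv : ∀ j, f j ≠ 0 → j / n ≤ L := fun j hj => by
    by_contra h
    exact hj (if_neg h)
  have hf : ∀ (i : Fin n) (t : ℕ), t ≤ L → f (n * t + i) = (w i).coeff (L - t) := by
    intro i t ht
    have h1 : (n * t + (i : ℕ)) / n = t := by
      rw [Nat.mul_add_div hn, Nat.div_eq_of_lt i.2, add_zero]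
    have h2 : (n * t + (i : ℕ)) % n = i := by rw [Nat.mul_add_mod, Nat.mod_eq_of_lt i.2]
    simp only [f, h1, h2, if_pos ht, Fin.eta]
  have hsupp : ∀ j, f j ≠ 0 → j ∈ Finset.range ((L + 1) * n) := fun j hj =>
    Finset.mem_range.mpr ((Nat.div_lt_iff_lt_mul hn).mp (Nat.lt_succ_iff.mpr (hfdiv j hj)))
  refine ⟨Finsupp.onFinset _ f hsupp, ?_, ?_, ?_⟩
  · obtain ⟨i, hi⟩ := Function.ne_iff.mp hw0
    obtain ⟨t, ht⟩ : ∃ t, (w i).coeff t ≠ 0 := by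
      by_contra! h
      exact hi (Polynomial.ext h)
    have htL : t ≤ L := (le_natDegree_of_ne_zero ht).trans (hdeg i)
    intro h
    have h1 := hf i (L - t) (Nat.sub_le _ _)
    rw [Nat.sub_sub_self htL] at h1
    exact ht (h1 ▸ DFunLike.congr_fun h (n * (L - t) + i))
  · rw [← hJ]
    refine Finset.card_le_card_of_injOn
      (fun j => (⟨j % n, Nat.mod_lt _ hn⟩, ⟨L - j / n, Nat.lt_succ_of_le (Nat.sub_le _ _)⟩)) ?_ ?_
    · intro j hj
      have hj' : f j ≠ 0 := by simpa using hj
      refine hwJ _ _ ?_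
      simpa only [f, if_pos (hfdiv j hj')] using hj'
    · intro j hj l hl h
      have hj' := hfdiv j (by simpa using hj)
      have hl' := hfdiv l (by simpa using hl)
      simp only [Prod.mk.injEq, Fin.mk.injEq] at h
      rw [← Nat.div_add_mod j n, ← Nat.div_add_mod l n, h.1,
        show j / n = l / n by omega]
  · rintro u ⟨x, rfl⟩
    rw [Finsupp.onFinset_sum _ (fun _ => mul_zero _), Finset.sum_range,
      ← finProdFinEquiv.sum_comp, Fintype.sum_prod_type, Finset.sum_comm]
    -- Reversal turns the pairing of sequences into a convolution, namely the coefficient of `D^L`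
    -- in `(x G) · w`.
    have h0 : ((x ᵥ* G) ⬝ᵥ w).coeff L = 0 := by
      rw [← dotProduct_mulVec, hGw, dotProduct_zero, coeff_zero]
    rw [← h0, dotProduct, finsetSum_coeff]
    refine Finset.sum_congr rfl fun i _ => ?_
    rw [coeff_mul, Finset.Nat.sum_antidiagonal_eq_sum_range_succ
      (fun s t => ((x ᵥ* G) i).coeff s * (w i).coeff t), Finset.sum_range]
    refine Finset.sum_congr rfl fun t _ => ?_
    rw [finProdFinEquiv_apply_val, add_comm, coeff_interleave,
      hf i t (Nat.lt_succ_iff.mp t.2)]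

end Classical

/-! ### Calculus of Pauli operators -/

section Pauli

variable {F : Type*} [Field F] (p : ℕ) [Fact p.Prime] [Algebra (ZMod p) F]

/-- The trace of the pairing `∑ i, b i * x i`. -/
def traceDot (b : ℕ →₀ F) (x : ℕ → F) : ZMod p :=
  Algebra.trace (ZMod p) F (b.sum fun i y => y * x i)

theorem traceDot_add_left (b b' : ℕ →₀ F) (x : ℕ → F) :
    traceDot p (b + b') x = traceDot p b x + traceDot p b' x := by
  rw [traceDot, Finsupp.sum_add_index' (fun _ => zero_mul _) fun _ _ _ => add_mul _ _ _, map_add]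
  rfl

theorem traceDot_add_right (b : ℕ →₀ F) (x y : ℕ → F) :
    traceDot p b (x + y) = traceDot p b x + traceDot p b y := by
  simp only [traceDot, ← map_add, ← Finsupp.sum_add, Pi.add_apply, mul_add]

theorem traceDot_zero_left (x : ℕ → F) : traceDot p (0 : ℕ →₀ F) x = 0 := by
  simp [traceDot]

theorem traceDot_zero_right (b : ℕ →₀ F) : traceDot p b 0 = 0 := by
  simp [traceDot, Finsupp.sum]

theorem traceDot_neg_left (b : ℕ →₀ F) (x : ℕ → F) : traceDot p (-b) x = -traceDot p b x := by
  rw [eq_neg_iff_add_eq_zero, ← traceDot_add_left, neg_add_cancel, traceDot_zero_left]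

theorem traceDot_neg_right (b : ℕ →₀ F) (x : ℕ → F) : traceDot p b (-x) = -traceDot p b x := by
  rw [eq_neg_iff_add_eq_zero, ← traceDot_add_right, neg_add_cancel, traceDot_zero_right]

theorem traceDot_mapDomain_add_right (s : ℕ) (b : ℕ →₀ F) (x : ℕ → F) :
    traceDot p (b.mapDomain (· + s)) x = traceDot p b fun i => x (i + s) := by
  rw [traceDot, Finsupp.sum_mapDomain_index (fun _ => zero_mul _) fun _ _ _ => add_mul _ _ _]
  rfl

theorem pauli_apply (c : ZMod p) (a b : ℕ →₀ F) (f : States F) (x : ℕ → F) :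
    (pauli p c a b : Module.End ℂ (States F)) f x =
      ZMod.stdAddChar (c + traceDot p b (x - a)) * f (x - a) := by
  rw [AddChar.map_add_eq_mul, mul_assoc]
  rfl

theorem pauli_zero : pauli p 0 (0 : ℕ →₀ F) 0 = 1 := by
  ext f x
  rw [pauli_apply]
  simp [traceDot_zero_left]

/-- Moving `Z(b)` past `X(a')` costs the phase `tr(b · a')`; the commutation rule comes from this
cocycle. -/
theorem pauli_mul (c c' : ZMod p) (a b a' b' : ℕ →₀ F) :
    pauli p c a b * pauli p c' a' b' =
      pauli p (c + c' + traceDot p b a') (a + a') (b + b') := by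
  ext f x
  rw [Units.val_mul, Module.End.mul_apply, pauli_apply, pauli_apply, pauli_apply, ← mul_assoc,
    ← AddChar.map_add_eq_mul, Finsupp.coe_add, ← sub_sub, traceDot_add_left,
    ← sub_add_cancel (x - ⇑a) (⇑a'), traceDot_add_right p b, add_sub_cancel_right]
  congr 2
  ring

theorem pauli_inv (c : ZMod p) (a b : ℕ →₀ F) :
    (pauli p c a b)⁻¹ = pauli p (traceDot p b a - c) (-a) (-b) := by
  rw [inv_eq_iff_mul_eq_one, pauli_mul, Finsupp.coe_neg, traceDot_neg_right, add_neg_cancel,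
    add_neg_cancel, ← pauli_zero p]
  congr 1
  ring

theorem opX_eq_pauli (a : ℕ →₀ F) : opX a = pauli p 0 a 0 := by
  ext f x
  rw [pauli_apply]
  simp [traceDot_zero_left, opX]

theorem opZ_eq_pauli (b : ℕ →₀ F) : opZ p b = pauli p 0 0 b := by
  ext f x
  rw [pauli_apply]
  simp [traceDot, opZ, chi]

/-- The two orders of multiplication differ only in the cocycle, so vanishing of the
trace-symplectic form suffices. -/
theorem commute_pauli {c c' : ZMod p} {a b a' b' : ℕ →₀ F}
    (h : traceDot p b a' = traceDot p b' a) : Commute (pauli p c a b) (pauli p c' a' b') := by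
  rw [Commute, SemiconjBy, pauli_mul, pauli_mul, h, add_comm a, add_comm b, add_comm c]

theorem pauli_mem_pauliGroupInf (a b : ℕ →₀ F) : pauli p 0 a b ∈ pauliGroupInf F p := by
  obtain ⟨N, hN⟩ := (a.support ∪ b.support).exists_nat_subset_range
  have hz : ∀ i, N ≤ i → a i = 0 ∧ b i = 0 := by
    intro i hi
    by_contra h
    have : i ∈ a.support ∪ b.support := by
      simpa [Finset.mem_union, ← not_and_or] using h
    exact absurd (Finset.mem_range.mp (hN this)) (not_lt.mpr hi)
  have h : pauli p 0 a b = opX a * opZ p b := by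
    rw [opX_eq_pauli p, opZ_eq_pauli, pauli_mul]
    simp [traceDot_zero_left]
  rw [h]
  refine Subgroup.mem_iSup_of_mem N (mul_mem ?_ ?_)
  · exact Subgroup.subset_closure (Or.inl ⟨a, fun i hi => (hz i hi).1, rfl⟩)
  · exact Subgroup.subset_closure (Or.inr ⟨b, fun i hi => (hz i hi).2, rfl⟩)

/-- The Pauli operators `ω^c X(a) Z(b)` with `(a, b)` in an additive group `A`. -/
def pauliSubgroup (A : AddSubgroup ((ℕ →₀ F) × (ℕ →₀ F))) : Subgroup (Op F) where
  carrier := {E | ∃ (c : ZMod p) (v : (ℕ →₀ F) × (ℕ →₀ F)), v ∈ A ∧ E = pauli p c v.1 v.2}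
  one_mem' := ⟨0, 0, A.zero_mem, (pauli_zero p).symm⟩
  mul_mem' := by
    rintro _ _ ⟨c, v, hv, rfl⟩ ⟨c', v', hv', rfl⟩
    exact ⟨_, v + v', A.add_mem hv hv', pauli_mul p _ _ _ _ _ _⟩
  inv_mem' := by
    rintro _ ⟨c, v, hv, rfl⟩
    exact ⟨_, -v, A.neg_mem hv, pauli_inv p _ _ _⟩

/-- The normal form `ω^c X(a) Z(b)` is closed under products and inverses, so checking generators is
enough. The support bound later makes the stabilizer space finite-dimensional. -/
theorem pauliGroup_le (N : ℕ) :
    pauliGroup F p N ≤ pauliSubgroup p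
      ((Finsupp.supported F F (Set.Iio N)).prod
        (Finsupp.supported F F (Set.Iio N))).toAddSubgroup := by
  have hsupp : ∀ a : ℕ →₀ F, (∀ i, N ≤ i → a i = 0) →
      a ∈ Finsupp.supported F F (Set.Iio N) := fun a ha =>
    (Finsupp.mem_supported' _ _).mpr fun i hi => ha i (not_lt.mp hi)
  rw [pauliGroup, Subgroup.closure_le]
  rintro _ (⟨a, ha, rfl⟩ | ⟨b, hb, rfl⟩)
  · exact ⟨0, (a, 0), ⟨hsupp a ha, zero_mem _⟩, opX_eq_pauli p a⟩
  · exact ⟨0, (0, b), ⟨zero_mem _, hsupp b hb⟩, opZ_eq_pauli p b⟩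

theorem shift_pauli (s : ℕ) (c : ZMod p) (a b : ℕ →₀ F) :
    shift s (pauli p c a b) = pauli p c (a.mapDomain (· + s)) (b.mapDomain (· + s)) := by
  have hinj : Function.Injective (· + s : ℕ → ℕ) := add_left_injective s
  have ha : ∀ i, a.mapDomain (· + s) (i + s) = a i := Finsupp.mapDomain_apply hinj a
  ext f x
  change (pauli p c a b : Module.End ℂ (States F)) (fun y => f (splice s x y))
    (fun i => x (i + s)) = _
  rw [pauli_apply, pauli_apply, traceDot_mapDomain_add_right]
  have h1 : (fun i => (x - ⇑(a.mapDomain (· + s))) (i + s)) = (fun i => x (i + s)) - ⇑a := by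
    funext i
    simp only [Pi.sub_apply, ha]
  have h2 : splice s x ((fun i => x (i + s)) - ⇑a) = x - ⇑(a.mapDomain (· + s)) := by
    funext i
    rw [splice]
    split_ifs with hi
    · rw [Pi.sub_apply, Finsupp.mapDomain_of_notMem_range, sub_zero]
      rintro ⟨j, rfl⟩
      simp at hi
    · obtain ⟨j, rfl⟩ := Nat.exists_eq_add_of_le' (not_lt.mp hi)
      rw [Nat.add_sub_cancel, Pi.sub_apply, Pi.sub_apply, ha]
  rw [h1, h2]

/-! ### Uniqueness of the components of a Pauli operator -/

variable [Finite F]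

theorem eq_zero_of_trace_mul_eq_zero {y : F}
    (h : ∀ z, Algebra.trace (ZMod p) F (y * z) = 0) : y = 0 := by
  refine (traceForm_nondegenerate (ZMod p) F).1 y fun z => ?_
  rw [Algebra.traceForm_apply, h]

/-- A Pauli operator determines its components up to phases. -/
theorem pauli_eq_smul_pauli {c c' : ZMod p} {a b a' b' : ℕ →₀ F} {z : ℂ}
    (h : (pauli p c a b : Module.End ℂ (States F)) =
      z • (pauli p c' a' b' : Module.End ℂ (States F))) : a = a' ∧ b = b' := by
  classical
  have key : ∀ (f : States F) (x : ℕ → F),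
      ZMod.stdAddChar (c + traceDot p b (x - a)) * f (x - a) =
        z * (ZMod.stdAddChar (c' + traceDot p b' (x - a')) * f (x - a')) := by
    intro f x
    rw [← pauli_apply, h, LinearMap.smul_apply, Pi.smul_apply, pauli_apply, smul_eq_mul]
  have hne : ∀ e : ZMod p, (ZMod.stdAddChar e : ℂ) ≠ 0 := by
    intro e
    refine left_ne_zero_of_mul_eq_one (b := ZMod.stdAddChar (-e)) ?_
    rw [← AddChar.map_add_eq_mul, add_neg_cancel, AddChar.map_zero_eq_one]
  have haa : a = a' := by
    -- Test on the basis state `|-a⟩`, evaluated at `0`: the left side is a nonzero phase, and the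
    -- right side vanishes unless `a = a'`.
    have h1 := key (Pi.single (-⇑a) 1) 0
    by_contra hne'
    have h2 : (0 : ℕ → F) - ⇑a' ≠ -⇑a := by
      rw [zero_sub, Ne, neg_inj]
      exact fun h => hne' (DFunLike.coe_injective h).symm
    rw [Pi.single_eq_of_ne h2, zero_sub, Pi.single_eq_same] at h1
    simp only [mul_zero, mul_one] at h1
    exact hne _ h1
  subst haa
  have h3 : ∀ x : ℕ → F, (ZMod.stdAddChar (c + traceDot p b x) : ℂ) =
      z * ZMod.stdAddChar (c' + traceDot p b' x) := by
    intro x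
    -- With equal translations, the constant state compares the characters alone; the value at `0`
    -- then eliminates `z`.
    have := key 1 (x + a)
    simpa using this
  have h4 : ∀ x : ℕ → F, traceDot p b x = traceDot p b' x := by
    intro x
    have h0 := h3 0
    have hx := h3 x
    rw [traceDot_zero_right, traceDot_zero_right, add_zero, add_zero] at h0
    rw [AddChar.map_add_eq_mul, AddChar.map_add_eq_mul, ← mul_assoc, ← h0] at hx
    exact ZMod.injective_stdAddChar (mul_left_cancel₀ (hne c) hx)
  refine ⟨rfl, sub_eq_zero.mp (Finsupp.ext fun i => eq_zero_of_trace_mul_eq_zero p fun t => ?_)⟩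
  -- A sequence concentrated at position `i` isolates one component of `b - b'`, and nondegeneracy
  -- of the trace form kills it.
  have h5 : traceDot p (b - b') (Pi.single i t) = 0 := by
    rw [sub_eq_add_neg, traceDot_add_left, traceDot_neg_left, h4, add_neg_cancel]
  rw [← h5, traceDot, Finsupp.sum]
  congr 1
  by_cases hi : i ∈ (b - b').support
  · rw [Finset.sum_eq_single_of_mem i hi fun j _ hj => by simp [Pi.single_eq_of_ne hj],
      Pi.single_eq_same]
  · rw [Finsupp.notMem_support_iff.mp hi, zero_mul, Finset.sum_eq_zero]
    intro j hj
    rw [Pi.single_eq_of_ne (ne_of_mem_of_not_mem hj hi), mul_zero]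

theorem pauli_inj {c c' : ZMod p} {a b a' b' : ℕ →₀ F} (h : pauli p c a b = pauli p c' a' b') :
    a = a' ∧ b = b' :=
  pauli_eq_smul_pauli p (z := 1) (by rw [h, one_smul])

end Pauli

/-! ### The rank of the code of a convolutional stabilizer -/

section Rank

variable {F : Type*} [Field F]

/-- The sequence `a` cut into frames of length `n`: the inverse of `interleave`. -/
def frames (n : ℕ) : (ℕ →₀ F) →ₗ[F] (Fin n → F[X]) where
  toFun a i := ⟨.ofCoeff (a.comapDomain (fun t => n * t + i) fun s _ t _ h => by
    have hn : 0 < n := i.pos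
    exact Nat.eq_of_mul_eq_mul_left hn (Nat.add_right_cancel h))⟩
  map_add' _ _ := by
    ext
    rfl
  map_smul' _ _ := by
    ext
    rfl

theorem coeff_frames (n : ℕ) (a : ℕ →₀ F) (i : Fin n) (t : ℕ) :
    (frames n a i).coeff t = a (n * t + i) :=
  rfl

/-- A delay by `t` whole frames is multiplication by `D^t`. Hence the shifted copies of `S₀` that
generate `S` stay inside the `F[D]`-module generated by `S₀`. -/
theorem frames_mapDomain (n t : ℕ) (a : ℕ →₀ F) :
    frames n (a.mapDomain (· + t * n)) = (X ^ t : F[X]) • frames n a := by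
  have hinj : Function.Injective (· + t * n : ℕ → ℕ) := add_left_injective _
  ext i s
  rw [coeff_frames, Pi.smul_apply, smul_eq_mul, coeff_X_pow_mul']
  split_ifs with h
  · obtain ⟨s, rfl⟩ := Nat.exists_eq_add_of_le' h
    rw [Nat.add_sub_cancel, coeff_frames, ← Finsupp.mapDomain_apply hinj a]
    congr 1
    ring
  · rw [Finsupp.mapDomain_of_notMem_range]
    rintro ⟨j, hj⟩
    have h1 : n * (s + 1) ≤ n * t := Nat.mul_le_mul_left n (not_le.mp h)
    have h2 := i.2
    have h3 : n * (s + 1) = n * s + n := by ring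
    have h4 : t * n = n * t := mul_comm _ _
    simp only at hj
    omega

/-- `frames` on pairs of sequences. -/
def framesPair (n : ℕ) :
    ((ℕ →₀ F) × (ℕ →₀ F)) →ₗ[F] ((Fin n → F[X]) × (Fin n → F[X])) :=
  (frames n).prodMap (frames n)

variable (p : ℕ) [Fact p.Prime] [Algebra (ZMod p) F]

/-- The pairs of sequences in the stabilizer lie in the `F[D]`-module generated by `S₀`. -/
theorem stabInf_le_pauliSubgroup {n : ℕ} {S₀ : Subgroup (Op F)} {N : ℕ}
    (h : S₀ ≤ pauliGroup F p N) :
    stabInf n S₀ ≤ pauliSubgroup p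
      ((Submodule.span F[X] (framesPair n '' modPhases p S₀)).toAddSubgroup.comap
        (framesPair (F := F) n).toAddMonoidHom) := by
  have h0 : ∀ E ∈ S₀, ∃ (c : ZMod p) (v : (ℕ →₀ F) × (ℕ →₀ F)),
      framesPair n v ∈ Submodule.span F[X] (framesPair n '' modPhases p S₀) ∧
        E = pauli p c v.1 v.2 := by
    intro E hE
    obtain ⟨c, v, -, rfl⟩ := pauliGroup_le p N (h hE)
    exact ⟨c, v, Submodule.subset_span ⟨v, ⟨c, hE⟩, rfl⟩, rfl⟩
  refine iSup_le fun t => ?_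
  induction t with
  | zero => exact h0
  | succ t ih =>
    refine sup_le ih ?_
    rintro _ ⟨E, hE, rfl⟩
    obtain ⟨c, v, hv, rfl⟩ := h0 E hE
    refine ⟨c, (v.1.mapDomain (· + (t + 1) * n), v.2.mapDomain (· + (t + 1) * n)), ?_,
      shift_pauli p _ c v.1 v.2⟩
    have h1 : framesPair n (v.1.mapDomain (· + (t + 1) * n), v.2.mapDomain (· + (t + 1) * n)) =
        (X ^ (t + 1) : F[X]) • framesPair n v :=
      Prod.ext (frames_mapDomain n (t + 1) v.1) (frames_mapDomain n (t + 1) v.2)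
    have h2 := Submodule.smul_mem _ (X ^ (t + 1) : F[X]) hv
    rw [← h1] at h2
    exact h2

variable [Finite F]

theorem framesPair_mem_span {n : ℕ} {S₀ : Subgroup (Op F)} {N : ℕ}
    (h : S₀ ≤ pauliGroup F p N) {c : ZMod p} {a b : ℕ →₀ F}
    (hE : pauli p c a b ∈ stabInf n S₀) :
    framesPair n (a, b) ∈ Submodule.span F[X] (framesPair n '' modPhases p S₀) := by
  obtain ⟨c', v, hv, hv'⟩ := stabInf_le_pauliSubgroup p h hE
  obtain ⟨rfl, rfl⟩ := pauli_inj p hv'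
  exact hv

/-- The `F[D]`-module generated by `S₀` has at most `dim S₀` linearly independent elements. -/
theorem card_le_finrank_of_mem_span {n : ℕ} {S₀ : Subgroup (Op F)} {N : ℕ}
    (h : S₀ ≤ pauliGroup F p N) (W : Submodule F ((ℕ →₀ F) × (ℕ →₀ F)))
    (hW : (W : Set ((ℕ →₀ F) × (ℕ →₀ F))) = modPhases p S₀)
    {ι : Type*} [Fintype ι] {v : ι → (Fin n → F[X]) × (Fin n → F[X])}
    (hv : LinearIndependent F[X] v)
    (hmem : ∀ i, v i ∈ Submodule.span F[X] (framesPair n '' modPhases p S₀)) :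
    Fintype.card ι ≤ Module.finrank F W := by
  classical
  -- Operators in `S₀` act on the first `N` qudits only, so `W` is finite-dimensional and has a
  -- basis of `finrank` elements.
  have hle : W ≤ (Finsupp.supported F F (Set.Iio N)).prod (Finsupp.supported F F (Set.Iio N)) := by
    intro w hw
    obtain ⟨c, hc⟩ : w ∈ modPhases p S₀ := hW ▸ hw
    obtain ⟨c', v, hv, hv'⟩ := pauliGroup_le p N (h hc)
    obtain ⟨h1, h2⟩ := pauli_inj p hv'
    have : w = v := Prod.ext h1 h2
    exact this ▸ hv
  have hfin1 : Module.Finite F (Finsupp.supported F F (Set.Iio N)) :=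
    Module.Finite.equiv (Finsupp.supportedEquivFinsupp (M := F) (R := F) (Set.Iio N)).symm
  have hfin2 : Module.Finite F
      ((Finsupp.supported F F (Set.Iio N)).prod (Finsupp.supported F F (Set.Iio N)) :
        Submodule F _) :=
    Module.Finite.iff_fg.mpr
      ((Module.Finite.iff_fg.mp hfin1).prod (Module.Finite.iff_fg.mp hfin1))
  have hfin : Module.Finite F W := Submodule.finiteDimensional_of_le hle
  have hfree : Module.Free F W := Module.Free.of_divisionRing F W
  let b := Module.finBasis F W
  let g : Fin (Module.finrank F W) → (Fin n → F[X]) × (Fin n → F[X]) := fun l =>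
    framesPair n (b l : (ℕ →₀ F) × (ℕ →₀ F))
  -- An `F`-basis of `W` generates the whole module over `F[D]`, which bounds the size of
  -- independent families.
  have hspan : Submodule.span F[X] (framesPair n '' modPhases p S₀) ≤
      Submodule.span F[X] (Set.range g) := by
    rw [Submodule.span_le, ← hW]
    rintro _ ⟨w, hw, rfl⟩
    have h1 : ((⟨w, hw⟩ : W) : (ℕ →₀ F) × (ℕ →₀ F)) = w := rfl
    rw [← h1, ← b.sum_repr ⟨w, hw⟩, Submodule.coe_sum, map_sum]
    refine Submodule.sum_mem _ fun l _ => ?_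
    rw [Submodule.coe_smul, map_smul]
    exact Submodule.smul_of_tower_mem _ _ (Submodule.subset_span ⟨l, rfl⟩)
  have hcard := linearIndependent_le_span' v hv (Set.range g)
    (by rintro _ ⟨i, rfl⟩; exact hspan (hmem i))
  rw [Cardinal.mk_fintype, Nat.cast_le] at hcard
  exact hcard.trans ((Fintype.card_range_le g).trans (Fintype.card_fin _).le)

end Rank

/-! ### From pairs over `F[D]` to vectors over `K[D]` -/

section Rank

variable {F : Type*} [Field F] {K : Type*} [Field K] [Algebra F K]

/-- The map `(A, B) ↦ x A + y B` from pairs of vectors over `F[D]` to vectors over `K[D]`. -/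
def combine (n : ℕ) (x y : K) :
    ((Fin n → F[X]) × (Fin n → F[X])) →ₛₗ[mapRingHom (algebraMap F K)] (Fin n → K[X]) where
  toFun v j := C x * (v.1 j).map (algebraMap F K) + C y * (v.2 j).map (algebraMap F K)
  map_add' v w := by
    funext j
    simp only [Prod.fst_add, Prod.snd_add, Pi.add_apply, Polynomial.map_add]
    ring
  map_smul' f v := by
    funext j
    simp only [Prod.smul_fst, Prod.smul_snd, Pi.smul_apply, smul_eq_mul, Polynomial.map_mul,
      coe_mapRingHom]
    ring

theorem combine_framesPair {n : ℕ} {x y : K} {a b : ℕ →₀ F} {u : Fin n → K[X]}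
    (h : ∀ j, (interleave u).coeff j = x * algebraMap F K (a j) + y * algebraMap F K (b j)) :
    combine n x y (framesPair n (a, b)) = u := by
  ext i t
  rw [← coeff_interleave u i t, h]
  change (C x * (frames n a i).map _ + C y * (frames n b i).map _).coeff t = _
  rw [coeff_add, coeff_C_mul, coeff_C_mul, coeff_map, coeff_map, coeff_frames, coeff_frames]

theorem coeff_interleave_combine {n : ℕ} (hn : 0 < n) (x y : K) (a b : ℕ →₀ F) (j : ℕ) :
    (interleave (combine n x y (framesPair n (a, b)))).coeff j =
      x * algebraMap F K (a j) + y * algebraMap F K (b j) := by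
  obtain ⟨i, t, rfl⟩ : ∃ (i : Fin n) (t : ℕ), j = n * t + i :=
    ⟨⟨j % n, Nat.mod_lt _ hn⟩, j / n, (Nat.div_add_mod j n).symm⟩
  rw [coeff_interleave]
  change (C x * (frames n a i).map _ + C y * (frames n b i).map _).coeff t = _
  rw [coeff_add, coeff_C_mul, coeff_C_mul, coeff_map, coeff_map, coeff_frames, coeff_frames]

/-- If the rows of `G` are independent, so are their multiples by a basis of `K` over `F`, as
elements of an `F[D]`-module. -/
theorem linearIndependent_of_combine_eq {n r : ℕ} {x y : K} (hxy : LinearIndependent F ![x, y])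
    {G : Matrix (Fin r) (Fin n) K[X]} (hG : ∃ H : Matrix (Fin n) (Fin r) K[X], G * H = 1)
    {f : Fin r → K[X]} (hf : ∀ i, f i ≠ 0)
    {v : Fin r × Fin 2 → (Fin n → F[X]) × (Fin n → F[X])}
    (hv : ∀ i e, combine n x y (v (i, e)) = ![x, y] e • f i • G i) :
    LinearIndependent F[X] v := by
  obtain ⟨H, hH⟩ := hG
  rw [Fintype.linearIndependent_iff]
  intro g hg
  -- Collecting the terms of each row turns an `F[D]`-relation into a `K[D]`-relation among the rows
  -- of `G`, which the right inverse annuls. Independence of `x, y` over `F` then separates the two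
  -- terms coefficientwise.
  have h1 : (fun i => (∑ e, (g (i, e)).map (algebraMap F K) * C (![x, y] e)) * f i) ᵥ* G = 0 := by
    have h2 := congrArg (combine n x y) hg
    rw [map_sum, map_zero, Fintype.sum_prod_type] at h2
    rw [← h2]
    ext1 j
    rw [vecMul, dotProduct, Finset.sum_apply]
    refine Finset.sum_congr rfl fun i _ => ?_
    rw [Finset.sum_apply, Finset.sum_mul, Finset.sum_mul]
    refine Finset.sum_congr rfl fun e _ => ?_
    rw [map_smulₛₗ, hv, Pi.smul_apply, Pi.smul_apply, Pi.smul_apply, smul_eq_mul, smul_eq_mul,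
      smul_eq_C_mul, coe_mapRingHom]
    ring
  have h3 := congrArg (· ᵥ* H) h1
  simp only [vecMul_vecMul, hH, vecMul_one, zero_vecMul] at h3
  rintro ⟨i, e⟩
  have h4 := (mul_eq_zero.mp (congrFun h3 i)).resolve_right (hf i)
  ext t
  have h5 := congrArg (coeff · t) h4
  simp only [finsetSum_coeff, coeff_mul_C, coeff_map, coeff_zero] at h5
  refine Fintype.linearIndependent_iff.mp hxy (fun e => (g (i, e)).coeff t) ?_ e
  simpa only [Algebra.smul_def] using h5

variable (p : ℕ) [Fact p.Prime] [Algebra (ZMod p) F] [Fintype F]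

/-- The code of an `[(n, k, m)]` convolutional stabilizer has rank at most `(n - k) / 2`. -/
theorem two_mul_rank_le {n k m r : ℕ} {S₀ : Subgroup (Op F)} (hS : IsConvStabilizer p n k m S₀)
    {β : K} (hβ : LinearIndependent F ![β, β ^ Fintype.card F])
    (hlin : IsLinearCode p n β (stabInf n S₀))
    {G : Matrix (Fin r) (Fin n) K[X]} (hG : ∃ H : Matrix (Fin n) (Fin r) K[X], G * H = 1)
    (hsat : rowCode G ⊆ saturation (assocCode p n β (stabInf n S₀))) :
    2 * r ≤ n - k := by
  obtain ⟨U, hU⟩ := hlin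
  have hrow : ∀ i, G i ∈ rowCode G := fun i => ⟨Pi.single i 1, (single_one_vecMul i G).symm⟩
  -- The multiplier `f i` brings row `i` of `G` from the saturation into the code itself.
  choose f hf hfG using fun i => hsat (hrow i)
  have hmem : ∀ i (e : Fin 2), ![β, β ^ Fintype.card F] e • f i • G i ∈
      assocCode p n β (stabInf n S₀) := by
    intro i e
    -- Here `K`-linearity enters: both the `β` and the `β^q` multiple remain in the code, doubling
    -- the count of independent elements.
    rw [← hU] at hfG ⊢
    exact U.smul_mem _ (hfG i)
  choose c a b hab hcoeff using hmem
  obtain ⟨W, hW, hWr⟩ := hS.s2 0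
  have h := card_le_finrank_of_mem_span p hS.subgroup W hW
    (v := fun ie : Fin r × Fin 2 => framesPair n (a ie.1 ie.2, b ie.1 ie.2))
    (linearIndependent_of_combine_eq hβ hG hf fun i e => combine_framesPair (hcoeff i e))
    (fun ie => framesPair_mem_span p hS.subgroup (hab ie.1 ie.2))
  rw [hWr, Fintype.card_prod, Fintype.card_fin, Fintype.card_fin] at h
  omega

end Rank

/-! ### The Hermitian form and the Singleton bound -/

section Bound

variable {F : Type*} [Field F] {K : Type*} [Field K] [Algebra F K]

/-- Coordinates with respect to a basis with two elements. -/
theorem exists_coordinates (hK : Module.finrank F K = 2) {x y : K}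
    (hxy : LinearIndependent F ![x, y]) :
    ∃ A B : K →ₗ[F] F, ∀ z, x * algebraMap F K (A z) + y * algebraMap F K (B z) = z := by
  let b := basisOfLinearIndependentOfCardEqFinrank hxy (by rw [Fintype.card_fin, hK])
  refine ⟨b.coord 0, b.coord 1, fun z => ?_⟩
  conv_rhs => rw [← b.sum_repr z]
  rw [Fin.sum_univ_two, Algebra.smul_def, Algebra.smul_def]
  simp [b, mul_comm]

theorem sq_ne_sq_of_linearIndependent {x y : K} (hxy : LinearIndependent F ![x, y]) :
    x ^ 2 ≠ y ^ 2 := by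
  rw [LinearIndependent.pair_iff] at hxy
  intro h
  rcases sq_eq_sq_iff_eq_or_eq_neg.mp h with h | h
  · exact one_ne_zero (hxy 1 (-1) (by simp [h])).1
  · exact one_ne_zero (hxy 1 1 (by simp [h])).1

/-- Orthogonality for the Hermitian form implies orthogonality for the symplectic form. -/
theorem sum_mul_eq_of_hermitian {ι : Type*} (s : Finset ι) (φ : K →ₐ[F] K) {β : K}
    (hφ : ∀ x, φ (φ x) = x) (hβ : LinearIndependent F ![β, φ β]) {a b a' b' : ι → F} {u v : ι → K}
    (hu : ∀ j, u j = β * algebraMap F K (a' j) + φ β * algebraMap F K (b' j))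
    (hv : ∀ j, v j = β * algebraMap F K (a j) + φ β * algebraMap F K (b j))
    (h : ∑ j ∈ s, u j * φ (v j) = 0) :
    ∑ j ∈ s, b j * a' j = ∑ j ∈ s, b' j * a j := by
  have h' : ∑ j ∈ s, φ (u j) * v j = 0 := by
    rw [← map_zero φ, ← h, map_sum]
    exact Finset.sum_congr rfl fun j _ => by rw [map_mul, hφ]
  -- The difference of the Hermitian form and its conjugate is `β² - φ(β)²` times the symplectic
  -- form; the `a a'` and `b b'` terms cancel.
  have key : (β ^ 2 - φ β ^ 2) *
      algebraMap F K (∑ j ∈ s, b j * a' j - ∑ j ∈ s, b' j * a j) = 0 := by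
    have h0 : ∑ j ∈ s, u j * φ (v j) - ∑ j ∈ s, φ (u j) * v j = 0 := by rw [h, h', sub_zero]
    rw [← h0, ← Finset.sum_sub_distrib, ← Finset.sum_sub_distrib, map_sum, Finset.mul_sum]
    refine Finset.sum_congr rfl fun j _ => ?_
    simp only [hu, hv, map_add, map_mul, map_sub, AlgHom.commutes, hφ]
    ring
  have h1 := (mul_eq_zero.mp key).resolve_left
    (sub_ne_zero.mpr (sq_ne_sq_of_linearIndependent hβ))
  exact sub_eq_zero.mp ((map_eq_zero _).mp h1)

variable (p : ℕ) [Fact p.Prime] [Algebra (ZMod p) F] [Fintype F]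

/-- A sequence that is orthogonal to the associated code gives a nontrivial Pauli operator of the
same weight that commutes with the stabilizer. -/
theorem exists_commuting_pauli (hK : Module.finrank F K = 2) {β : K}
    (hβ : LinearIndependent F ![β, β ^ Fintype.card F]) {n : ℕ} (hn : 0 < n)
    {S : Subgroup (Op F)}
    (hS : ∀ M ∈ S, ∃ (c : ZMod p) (a b : ℕ →₀ F), M = pauli p c a b)
    {y : ℕ →₀ K} (hy : y ≠ 0)
    (hyS : ∀ u ∈ assocCode p n β S, (y.sum fun j z => (interleave u).coeff j * z) = 0) :
    ∃ a b : ℕ →₀ F, (a, b) ≠ 0 ∧ {i | a i ≠ 0 ∨ b i ≠ 0}.ncard ≤ y.support.card ∧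
      ∀ M ∈ S, Commute (pauli p 0 a b) M := by
  classical
  have : Module.Finite F K := Module.finite_of_finrank_pos (by omega)
  have : Finite K := Module.finite_of_finite F
  have := Fintype.ofFinite K
  let φ : K →ₐ[F] K := FiniteField.frobeniusAlgHom F K
  have hφ : ∀ x, φ x = x ^ Fintype.card F := fun _ => rfl
  -- Since `|K| = q²`, the `q`-Frobenius is an involution.
  have hφφ : ∀ x, φ (φ x) = x := fun x => by
    rw [hφ, hφ, ← pow_mul, ← pow_two, ← hK, ← Module.card_eq_pow_finrank, FiniteField.pow_card]
  obtain ⟨A, B, hAB⟩ := exists_coordinates hK hβ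
  -- Coordinates are taken of the conjugate `φ (y j)`, so that the bilinear orthogonality of `y`
  -- becomes Hermitian orthogonality of the new sequence.
  let a : ℕ →₀ F := y.mapRange (fun z => A (φ z)) (by simp)
  let b : ℕ →₀ F := y.mapRange (fun z => B (φ z)) (by simp)
  have hab : ∀ j, φ (y j) = β * algebraMap F K (a j) + β ^ Fintype.card F * algebraMap F K (b j) :=
    fun j => (hAB _).symm
  refine ⟨a, b, fun h => hy ?_, ?_, ?_⟩
  · rw [Prod.mk_eq_zero] at h
    ext j
    have h1 := hab j
    rw [h.1, h.2] at h1
    simpa using h1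
  · rw [← Set.ncard_coe_finset]
    refine Set.ncard_le_ncard (fun i hi => ?_) (Finset.finite_toSet _)
    rw [Finset.mem_coe, Finsupp.mem_support_iff]
    intro h
    simp [a, b, h] at hi
  · intro M hM
    obtain ⟨c', a', b', rfl⟩ := hS M hM
    let u := combine n β (β ^ Fintype.card F) (framesPair n (a', b'))
    have hcoeff := coeff_interleave_combine hn β (β ^ Fintype.card F) a' b'
    have hu : u ∈ assocCode p n β S := ⟨c', a', b', hM, hcoeff⟩
    refine commute_pauli p ?_
    let s := y.support ∪ (b.support ∪ b'.support)
    have h0 : ∑ j ∈ s, (interleave u).coeff j * φ (φ (y j)) = 0 := by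
      rw [← hyS u hu, Finsupp.sum_of_support_subset y Finset.subset_union_left _ (by simp)]
      exact Finset.sum_congr rfl fun j _ => by rw [hφφ]
    rw [traceDot, traceDot, Finsupp.sum_of_support_subset b (s := s)
      (Finset.subset_union_left.trans Finset.subset_union_right) _ (by simp),
      Finsupp.sum_of_support_subset b' (s := s)
      (Finset.subset_union_right.trans Finset.subset_union_right) _ (by simp)]
    congr 1
    simp only [← hφ] at hβ hcoeff hab
    exact sum_mul_eq_of_hermitian s φ hφφ hβ hcoeff hab h0

end Bound

/-! ### Purity and the numerical bound -/

section Bound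

variable {F : Type*} [Field F] [Finite F] (p : ℕ) [Fact p.Prime] [Algebra (ZMod p) F]

/-- For a pure code, the weight of every nontrivial Pauli operator that commutes with the
stabilizer is at least the free distance. -/
theorem le_ncard_of_isPure {S : Subgroup (Op F)}
    (hS : ∀ M ∈ S, ∃ (c : ZMod p) (a b : ℕ →₀ F), M = pauli p c a b) {d : ℕ}
    (hd : IsFreeDistance p S d) (hpure : IsPure p S d) {a b : ℕ →₀ F} (hab : (a, b) ≠ 0)
    (hcomm : ∀ M ∈ S, Commute (pauli p 0 a b) M) :
    d ≤ {i | a i ≠ 0 ∨ b i ≠ 0}.ncard := by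
  by_contra! hlt
  -- A lighter operator would be detectable. As it commutes with `S`, some multiple of it lies in
  -- `S`, where purity excludes it.
  rcases hd.1 _ (pauli_mem_pauliGroupInf p a b) _ ⟨0, a, b, rfl, rfl⟩ hlt with
    ⟨M, hM, z, hz⟩ | ⟨M, hM, hMcomm⟩
  · obtain ⟨c', a', b', rfl⟩ := hS M hM
    obtain ⟨rfl, rfl⟩ := pauli_eq_smul_pauli p hz
    refine absurd (hpure _ hM (fun h => hab ?_) _ ⟨c', a', b', rfl, rfl⟩) (not_le.mpr hlt)
    rw [← pauli_zero p] at h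
    exact Prod.ext (pauli_inj p h).1 (pauli_inj p h).2
  · exact hMcomm (hcomm M hM)

end Bound

/-- The Singleton bound is monotone in the rank `r` of the code. -/
theorem singleton_bound_mono {n k r δ : ℕ} (hn : 0 < n) (hk : k ≤ n) (hr : 2 * r ≤ n - k) :
    ((r * (δ / (n - r) + 1) + δ + 1 : ℕ) : ℝ) ≤
      ((n : ℝ) - k) / 2 * (⌊2 * (δ : ℝ) / ((n : ℝ) + k)⌋ + 1) + δ + 1 := by
  have hrn : r < n := by omega
  have hr' : 2 * (r : ℝ) ≤ n - k := by
    rw [← Nat.cast_sub hk]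
    exact_mod_cast hr
  have hnr : (0 : ℝ) < (n : ℝ) - r := sub_pos.mpr (Nat.cast_lt.mpr hrn)
  have hnk : (0 : ℝ) < (n : ℝ) + k := by positivity
  have hfloor : ((δ / (n - r) : ℕ) : ℝ) ≤ (⌊2 * (δ : ℝ) / ((n : ℝ) + k)⌋ : ℝ) := by
    have h1 : ((δ / (n - r) : ℕ) : ℤ) ≤ ⌊2 * (δ : ℝ) / ((n : ℝ) + k)⌋ := by
      rw [Int.le_floor, Int.cast_natCast]
      refine Nat.cast_div_le.trans ?_
      rw [Nat.cast_sub hrn.le, div_le_div_iff₀ hnr hnk]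
      -- From `2r ≤ n - k` follows `n + k ≤ 2(n - r)`, so `δ/(n-r) ≤ 2δ/(n+k)`.
      nlinarith [Nat.cast_nonneg (α := ℝ) δ]
    rw [← Int.cast_natCast]
    exact Int.cast_le.mpr h1
  push_cast
  gcongr <;> linarith

end QConv

end

theorem mainTheorem1 {p : ℕ} [Fact p.Prime]
    {F : Type*} [Field F] [Fintype F] [Algebra (ZMod p) F]
    {K : Type*} [Field K] [Algebra F K] (hK : Module.finrank F K = 2)
    (β : K) (hβ : LinearIndependent F ![β, β ^ Fintype.card F])
    (n k m δ d : ℕ) (S₀ : Subgroup (QConv.Op F))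
    (hS : QConv.IsConvStabilizer p n k m S₀)
    (hlin : QConv.IsLinearCode p n β (QConv.stabInf n S₀))
    (hδ : QConv.HasDegree (QConv.assocCode p n β (QConv.stabInf n S₀)) δ)
    (hd : QConv.IsFreeDistance p (QConv.stabInf n S₀) d)
    (hpure : QConv.IsPure p (QConv.stabInf n S₀) d) :
    (d : ℝ) ≤ ((n : ℝ) - k) / 2 * (⌊2 * (δ : ℝ) / ((n : ℝ) + k)⌋ + 1) + δ + 1 := by
  obtain ⟨r, G, hG, hsat, hdeg, -⟩ := hδ
  have hn := hS.pos
  have hr := QConv.two_mul_rank_le p hS hβ hlin hG hsat.ge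
  have hrn : r < n := by omega
  -- `L = ⌊δ/(n-r)⌋` is the least `L` leaving more unknowns than equations, that is, `δ <
  -- (n-r)(L+1)`.
  have hL : r * (δ / (n - r) + 1) + δ < n * (δ / (n - r) + 1) := by
    have h1 : δ < (n - r) * (δ / (n - r) + 1) := Nat.lt_mul_div_succ δ (Nat.sub_pos_of_lt hrn)
    rw [Nat.sub_mul] at h1
    omega
  obtain ⟨y, hy0, hyw, hy⟩ := QConv.exists_stream_orthogonal hn G hdeg hL
  have hpauli : ∀ M ∈ QConv.stabInf n S₀, ∃ (c : ZMod p) (a b : ℕ →₀ F),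
      M = QConv.pauli p c a b := by
    intro M hM
    obtain ⟨c, v, -, rfl⟩ := QConv.stabInf_le_pauliSubgroup p hS.subgroup hM
    exact ⟨c, v.1, v.2, rfl⟩
  obtain ⟨a, b, hab, hw, hcomm⟩ := QConv.exists_commuting_pauli p hK hβ hn hpauli hy0 fun u hu =>
    hy u (hsat ▸ ⟨1, one_ne_zero, by rwa [one_smul]⟩)
  exact le_trans (Nat.cast_le.mpr
    ((QConv.le_ncard_of_isPure p hpauli hd hpure hab hcomm).trans (hw.trans hyw)))
    (QConv.singleton_bound_mono hn hS.le hr)
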